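/- Call a function $f:\mathbb{R}^d\to\mathbb{R}$ DC if it is the difference of two convex functions on $\mathbb{R}^d$. Call a set $P\subset\mathbb{R}^2$ a DC graph if it is a rotated copy of $\{(t,f(t)) : t\in I\}$ for some DC function $f:\mathbb{R}\to\mathbb{R}$ and some nonempty compact (possibly degenerate) interval $I\subset\mathbb{R}$. Let $F\subset\mathbb{R}^2$ be a closed set which is either empty or such that its distance function $d_F(x)=\operatorname{dist}(x,F)=\inf_{y\in F}|x-y|$ (with the Euclidean norm $|\cdot|$) is DC on $\mathbb{R}^2$. Then the boundary $\partial F$ is a subset of the union of a locally finite system of DC graphs, that is, of a system $\mathcal{G}$ of DC graphs such that every point of $\mathbb{R}^2$ has a neighbourhood which meets only finitely many members of $\mathcal{G}$. -/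

import Mathlib

/-- `f : E → ℝ` is a DC function (on the whole space): a difference of two convex functions. -/
def IsDC {E : Type*} [AddCommGroup E] [Module ℝ E] (f : E → ℝ) : Prop :=
  ∃ g h : E → ℝ, ConvexOn ℝ Set.univ g ∧ ConvexOn ℝ Set.univ h ∧ ∀ x, f x = g x - h x

/-- The system consisting of the empty set and of all nonempty closed subsets of `ℝ^d`
whose (Euclidean) distance function is DC. -/
def DCDistanceSets (d : ℕ) : Set (Set (EuclideanSpace ℝ (Fin d))) :=
  {∅} ∪ {A | A.Nonempty ∧ IsClosed A ∧ IsDC (fun x => Metric.infDist x A)}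

/-- The rotation of the plane about the origin by the angle `θ`. -/
noncomputable def planeRotation (θ : ℝ) (p : EuclideanSpace ℝ (Fin 2)) :
    EuclideanSpace ℝ (Fin 2) :=
  !₂[Real.cos θ * p 0 - Real.sin θ * p 1, Real.sin θ * p 0 + Real.cos θ * p 1]

/-- The graph of the restriction of `f : ℝ → ℝ` to `I`, as a subset of the plane. -/
def graphOver (f : ℝ → ℝ) (I : Set ℝ) : Set (EuclideanSpace ℝ (Fin 2)) :=
  (fun t : ℝ => !₂[t, f t]) '' I

/-- A DC graph in the plane: a rotated copy of the graph of `f` restricted to a nonempty compact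
(possibly degenerate) interval `[a, b]`, where `f : ℝ → ℝ` is a DC function. -/
def IsDCGraph (P : Set (EuclideanSpace ℝ (Fin 2))) : Prop :=
  ∃ (f : ℝ → ℝ) (a b θ : ℝ), IsDC f ∧ a ≤ b ∧
    P = planeRotation θ '' graphOver f (Set.Icc a b)

open Set Filter Topology
open scoped RealInnerProductSpace

/-! ### Functions that are differences of convex functions -/

/-! Write `d_F = g - h` with `g`, `h` convex. Near a boundary point `x`, the distance grows at unit
rate from a nearest point `z ∈ F` to a point `y ∉ F`, so subgradients of `g` at `y` and of `h` at
`z` differ by at least 1. In the limit, `d_F ≥ 0 = d_F x` makes the one for `h` a subgradient of `g`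
as well: the subdifferential of `g` at `x` has diameter at least 1, so in some coordinate it
straddles an interval `[k/4, (k+1)/4]`. On a bounded set finitely many `k` suffice. Fix the
coordinate `s` and slopes `c < c'`. For `e = c, c'` the partial conjugate `inf_s (G (t, s) - e * s)`
is convex in `t`; at a straddling point both infima are attained at the same `s`, so their
difference is `(c' - c) * s` and `s` is a DC function of `t` (`ConvexOn.exists_isDC_of_slopeGap`).
Clipping to unit cells gives local finiteness. -/

theorem IsDC.neg {E : Type*} [AddCommGroup E] [Module ℝ E] {f : E → ℝ} (hf : IsDC f) :
    IsDC (fun x => -f x) := by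
  obtain ⟨g, h, hg, hh, hfgh⟩ := hf
  exact ⟨h, g, hh, hg, fun x => by simp only [hfgh]; ring⟩

theorem IsDC.max_const {E : Type*} [AddCommGroup E] [Module ℝ E] {f : E → ℝ} (hf : IsDC f)
    (c : ℝ) : IsDC (fun x => max (f x) c) := by
  obtain ⟨g, h, hg, hh, hfgh⟩ := hf
  refine ⟨g ⊔ fun x => h x + c, h, hg.sup (hh.add_const c), hh, fun x => ?_⟩
  simp only [Pi.sup_apply, hfgh]
  rw [← max_sub_sub_right]
  simp

theorem IsDC.min_const {E : Type*} [AddCommGroup E] [Module ℝ E] {f : E → ℝ} (hf : IsDC f)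
    (c : ℝ) : IsDC (fun x => min (f x) c) := by
  have h := (hf.neg.max_const (-c)).neg
  simpa [max_neg_neg] using h

theorem ConvexOn.iInf_snd {G : ℝ × ℝ → ℝ} (hG : ConvexOn ℝ univ G)
    (hb : ∀ t, BddBelow (range fun s => G (t, s))) :
    ConvexOn ℝ univ (fun t => ⨅ s, G (t, s)) := by
  refine ⟨convex_univ, fun t _ u _ a b ha hb' hab => ?_⟩
  refine le_of_forall_pos_le_add fun ε hε => ?_
  obtain ⟨s, hs⟩ := exists_lt_of_ciInf_lt (lt_add_of_pos_right (⨅ s, G (t, s)) hε)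
  obtain ⟨r, hr⟩ := exists_lt_of_ciInf_lt (lt_add_of_pos_right (⨅ s, G (u, s)) hε)
  have h1 : (⨅ s, G (a • t + b • u, s)) ≤ G (a • t + b • u, a • s + b • r) := ciInf_le (hb _) _
  have h2 := hG.2 (mem_univ (t, s)) (mem_univ (u, r)) ha hb' hab
  simp only [Prod.smul_mk, Prod.mk_add_mk, smul_eq_mul] at h1 h2 ⊢
  have h3 := mul_le_mul_of_nonneg_left hs.le ha
  have h4 := mul_le_mul_of_nonneg_left hr.le hb'
  have h5 : a * ε + b * ε = ε := by rw [← add_mul, hab, one_mul]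
  linarith

/-- `SlopeGap G c c' t s` says that `G` has two supporting affine functions at `(t, s)` whose slopes
in the second variable are at most `c` and at least `c'`. -/
def SlopeGap (G : ℝ × ℝ → ℝ) (c c' t s : ℝ) : Prop :=
  ∃ a b a' b' : ℝ, b ≤ c ∧ c' ≤ b' ∧
    (∀ u v, G (t, s) + a * (u - t) + b * (v - s) ≤ G (u, v)) ∧
    (∀ u v, G (t, s) + a' * (u - t) + b' * (v - s) ≤ G (u, v))

theorem SlopeGap.bddBelow {G : ℝ × ℝ → ℝ} {c c' t s : ℝ} (h : SlopeGap G c c' t s) {e : ℝ}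
    (h1 : c ≤ e) (h2 : e ≤ c') (u : ℝ) : BddBelow (range fun v => G (u, v) - e * v) := by
  obtain ⟨a, b, a', b', hb, hb', H, H'⟩ := h
  refine ⟨min (G (t, s) + a * (u - t) - b * s) (G (t, s) + a' * (u - t) - b' * s), ?_⟩
  rintro _ ⟨v, rfl⟩
  rcases le_total v 0 with hv | hv
  · refine (min_le_left _ _).trans ?_
    nlinarith [H u v, mul_nonneg_of_nonpos_of_nonpos (sub_nonpos.2 (hb.trans h1)) hv]
  · refine (min_le_right _ _).trans ?_
    nlinarith [H' u v, mul_nonneg (sub_nonneg.2 (h2.trans hb')) hv]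

/-- The support of smaller slope controls `v ≤ s`, that of larger slope `v ≥ s`, so `s` is a
minimiser for every intermediate `e`. -/
theorem SlopeGap.iInf_eq {G : ℝ × ℝ → ℝ} {c c' t s : ℝ} (h : SlopeGap G c c' t s) {e : ℝ}
    (h1 : c ≤ e) (h2 : e ≤ c') : (⨅ v, (G (t, v) - e * v)) = G (t, s) - e * s := by
  refine le_antisymm (ciInf_le (h.bddBelow h1 h2 t) s) (le_ciInf fun v => ?_)
  obtain ⟨a, b, a', b', hb, hb', H, H'⟩ := h
  rcases le_total v s with hv | hv
  · nlinarith [H t v, mul_nonneg_of_nonpos_of_nonpos (sub_nonpos.2 (hb.trans h1))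
      (sub_nonpos.2 hv)]
  · nlinarith [H' t v, mul_nonneg (sub_nonneg.2 (h2.trans hb')) (sub_nonneg.2 hv)]

/-- The points at which a convex function has a fixed gap between its slopes in the second variable
lie on the graph of a DC function. -/
theorem ConvexOn.exists_isDC_of_slopeGap {G : ℝ × ℝ → ℝ} (hG : ConvexOn ℝ univ G) {c c' : ℝ}
    (hc : c < c') : ∃ f : ℝ → ℝ, IsDC f ∧ ∀ t s, SlopeGap G c c' t s → s = f t := by
  by_cases hne : ∃ t s, SlopeGap G c c' t s
  swap
  · exact ⟨fun _ => 0, ⟨fun _ => 0, fun _ => 0, convexOn_const _ convex_univ,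
      convexOn_const _ convex_univ, by simp⟩, fun t s h => (hne ⟨t, s, h⟩).elim⟩
  obtain ⟨t₀, s₀, h₀⟩ := hne
  have hconv : ∀ e, c ≤ e → e ≤ c' → ConvexOn ℝ univ (fun t => ⨅ s, (G (t, s) - e * s)) := by
    intro e h1 h2
    have hlin : ConcaveOn ℝ univ (fun z : ℝ × ℝ => e * z.2) :=
      (e • LinearMap.snd ℝ ℝ ℝ).concaveOn convex_univ
    exact (hG.sub hlin).iInf_snd (h₀.bddBelow h1 h2)
  have hk : 0 ≤ (c' - c)⁻¹ := inv_nonneg.2 (sub_nonneg.2 hc.le)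
  refine ⟨fun t => (c' - c)⁻¹ * (⨅ s, (G (t, s) - c * s)) -
      (c' - c)⁻¹ * ⨅ s, (G (t, s) - c' * s),
    ⟨_, _, (hconv c le_rfl hc.le).smul hk, (hconv c' hc.le le_rfl).smul hk, fun t => rfl⟩,
    fun t s h => ?_⟩
  simp only [h.iInf_eq le_rfl hc.le, h.iInf_eq hc.le le_rfl]
  have : c' - c ≠ 0 := (sub_pos.2 hc).ne'
  field_simp
  ring

/-! ### Subgradients -/

section Subgradient

variable {E : Type*} [NormedAddCommGroup E] [InnerProductSpace ℝ E]

/-- `p` is a subgradient of `g` at `x`. -/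
def IsSubgradient (g : E → ℝ) (p x : E) : Prop :=
  ∀ y, g x + ⟪p, y - x⟫ ≤ g y

theorem ConvexOn.exists_isSubgradient [FiniteDimensional ℝ E] {g : E → ℝ}
    (hg : ConvexOn ℝ univ g) (x : E) : ∃ p, IsSubgradient g p x := by
  have hcont : Continuous g := hg.locallyLipschitz.continuous
  have hopen : IsOpen {z : E × ℝ | g z.1 < z.2} :=
    isOpen_lt (hcont.comp continuous_fst) continuous_snd
  have hconv : Convex ℝ {z : E × ℝ | g z.1 < z.2} := by
    simpa using hg.convex_strict_epigraph
  obtain ⟨f, hf⟩ := geometric_hahn_banach_point_open (x := (x, g x)) hconv hopen (by simp)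
  have hsplit : ∀ (y : E) (r : ℝ), f (y, r) = f (y, 0) + r * f (0, 1) := by
    intro y r
    have : ((y, r) : E × ℝ) = (y, 0) + r • (0, 1) := by simp
    rw [this, map_add, map_smul, smul_eq_mul]
  -- The separating hyperplane is not vertical, so dividing by `f (0, 1)` turns it into an affine
  -- support of `g`.
  have hpos : 0 < f (0, 1) := by
    have := hf (x, g x + 1) (by simp)
    rw [hsplit x (g x), hsplit x (g x + 1)] at this
    linarith
  set L : E →L[ℝ] ℝ := -((f (0, 1))⁻¹ • f.comp (ContinuousLinearMap.inl ℝ E ℝ)) with hL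
  refine ⟨(InnerProductSpace.toDual ℝ E).symm L, fun y => ?_⟩
  rw [InnerProductSpace.toDual_symm_apply]
  refine le_of_forall_pos_le_add fun ε hε => ?_
  have h1 := hf (y, g y + ε) (by simpa using hε)
  rw [hsplit x, hsplit y] at h1
  have h2 : L (y - x) * f (0, 1) = f (x, 0) - f (y, 0) := by
    have : f (y - x, 0) = f (y, 0) - f (x, 0) := by rw [← map_sub]; simp
    simp only [hL, neg_apply, smul_apply,
      ContinuousLinearMap.comp_apply, ContinuousLinearMap.inl_apply, this, smul_eq_mul]
    field_simp
    ring
  refine le_of_mul_le_mul_right ?_ hpos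
  linarith

theorem IsSubgradient.of_tendsto {g : E → ℝ} (hg : Continuous g) {p x : ℕ → E} {p₀ x₀ : E}
    (h : ∀ n, IsSubgradient g (p n) (x n)) (hp : Tendsto p atTop (𝓝 p₀))
    (hx : Tendsto x atTop (𝓝 x₀)) : IsSubgradient g p₀ x₀ := fun y =>
  le_of_tendsto (((hg.tendsto _).comp hx).add (hp.inner (tendsto_const_nhds.sub hx)))
    (Eventually.of_forall fun n => h n y)

theorem exists_norm_le_of_isSubgradient [FiniteDimensional ℝ E] {g : E → ℝ} (hg : Continuous g)
    (R : ℝ) : ∃ L, ∀ x p, ‖x‖ ≤ R → IsSubgradient g p x → ‖p‖ ≤ L := by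
  obtain ⟨M, hM⟩ := (isCompact_closedBall (0 : E) (R + 1)).exists_bound_of_continuousOn
    hg.continuousOn
  refine ⟨2 * M, fun x p hx hp => ?_⟩
  rcases eq_or_ne p 0 with rfl | hp0
  · have h := (norm_nonneg _).trans (hM x (by simpa using hx.trans (by linarith)))
    simpa using h
  have hn : ‖p‖ ≠ 0 := norm_ne_zero_iff.2 hp0
  -- A unit step along `p` raises `g` by at least `‖p‖`, while `|g| ≤ M` at both ends.
  have h1 := hp (x + ‖p‖⁻¹ • p)
  have h2 : ⟪p, x + ‖p‖⁻¹ • p - x⟫ = ‖p‖ := by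
    rw [add_sub_cancel_left, inner_smul_right, real_inner_self_eq_norm_sq]
    field_simp
  rw [h2] at h1
  have h3 := hM x (by simpa using hx.trans (by linarith))
  have h4 := hM (x + ‖p‖⁻¹ • p) (by
    rw [mem_closedBall_zero_iff]
    refine (norm_add_le _ _).trans ?_
    rw [norm_smul, norm_inv, norm_norm, inv_mul_cancel₀ hn]
    linarith)
  rw [Real.norm_eq_abs, abs_le] at h3 h4
  linarith

/-- At every boundary point of a closed set whose distance function is the difference `g - h` of
convex functions, the subdifferential of `g` has diameter at least one. -/
theorem exists_isSubgradient_of_mem_frontier [FiniteDimensional ℝ E] {F : Set E}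
    (hF : IsClosed F) {g h : E → ℝ} (hg : ConvexOn ℝ univ g) (hh : ConvexOn ℝ univ h)
    (hd : ∀ x, Metric.infDist x F = g x - h x) {x : E} (hx : x ∈ frontier F) :
    ∃ p q, IsSubgradient g p x ∧ IsSubgradient g q x ∧ 1 ≤ ‖p - q‖ := by
  have hgc : Continuous g := hg.locallyLipschitz.continuous
  have hhc : Continuous h := hh.locallyLipschitz.continuous
  have hxF : x ∈ F := hF.frontier_subset hx
  have hne : F.Nonempty := ⟨x, hxF⟩
  rw [frontier_eq_closure_inter_closure] at hx
  obtain ⟨y, hy, hyx⟩ := mem_closure_iff_seq_limit.1 hx.2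
  choose z hzF hz using fun n => hF.exists_infDist_eq_dist hne (y n)
  have hzx : Tendsto z atTop (𝓝 x) := by
    have h0 : Tendsto (fun n => dist (y n) x) atTop (𝓝 0) := tendsto_iff_dist_tendsto_zero.1 hyx
    refine tendsto_iff_dist_tendsto_zero.2 (squeeze_zero (fun _ => dist_nonneg) (fun n => ?_)
      (by simpa using h0.add h0))
    calc dist (z n) x ≤ dist (z n) (y n) + dist (y n) x := dist_triangle _ _ _
      _ ≤ dist (y n) x + dist (y n) x := by
        rw [dist_comm, ← hz n]
        gcongr
        exact Metric.infDist_le_dist_of_mem hxF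
  choose p hp using fun n => hg.exists_isSubgradient (y n)
  choose q hq using fun n => hh.exists_isSubgradient (z n)
  -- Adding the two subgradient inequalities gives `‖y - z‖ = d_F y - d_F z ≤ ⟪p - q, y - z⟫`.
  have hpq : ∀ n, 1 ≤ ‖p n - q n‖ := by
    intro n
    have hne' : 0 < ‖y n - z n‖ := by
      rw [norm_pos_iff, sub_ne_zero]
      exact fun e => hy n (e ▸ hzF n)
    have h1 := hp n (z n)
    have h2 := hq n (y n)
    have h3 := hd (y n)
    have h4 := hd (z n)
    rw [Metric.infDist_zero_of_mem (hzF n)] at h4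
    rw [hz n, dist_eq_norm] at h3
    rw [← neg_sub (y n) (z n), inner_neg_right] at h1
    have h5 : ‖y n - z n‖ ≤ ⟪p n - q n, y n - z n⟫ := by rw [inner_sub_left]; linarith
    have h6 := h5.trans (real_inner_le_norm _ _)
    exact le_of_mul_le_mul_right (by linarith) hne'
  have hbound : ∀ {w : ℕ → E}, Tendsto w atTop (𝓝 x) → ∃ R, ∀ n, ‖w n‖ ≤ R := by
    intro w hw
    obtain ⟨R, hR⟩ := (Metric.isBounded_range_of_tendsto w hw).exists_norm_le
    exact ⟨R, fun n => hR _ (mem_range_self n)⟩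
  obtain ⟨R₁, hR₁⟩ := hbound hyx
  obtain ⟨R₂, hR₂⟩ := hbound hzx
  obtain ⟨L₁, hL₁⟩ := exists_norm_le_of_isSubgradient hgc R₁
  obtain ⟨L₂, hL₂⟩ := exists_norm_le_of_isSubgradient hhc R₂
  obtain ⟨⟨p₀, q₀⟩, -, φ, hφ, hlim⟩ :=
    ((isCompact_closedBall (0 : E) L₁).prod (isCompact_closedBall (0 : E) L₂)).tendsto_subseq
      (x := fun n => (p n, q n)) (fun n => ⟨by simpa using hL₁ _ _ (hR₁ n) (hp n),
        by simpa using hL₂ _ _ (hR₂ n) (hq n)⟩)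
  have hp₀ : Tendsto (p ∘ φ) atTop (𝓝 p₀) := (continuous_fst.tendsto _).comp hlim
  have hq₀ : Tendsto (q ∘ φ) atTop (𝓝 q₀) := (continuous_snd.tendsto _).comp hlim
  refine ⟨p₀, q₀, .of_tendsto hgc (fun n => hp (φ n)) hp₀ (hyx.comp hφ.tendsto_atTop),
    fun w => ?_, ge_of_tendsto (hp₀.sub hq₀).norm (Eventually.of_forall fun n => hpq (φ n))⟩
  -- `g - h` is minimal at `x`, so a subgradient of `h` there is also one of `g`.
  have h1 := IsSubgradient.of_tendsto hhc (fun n => hq (φ n)) hq₀ (hzx.comp hφ.tendsto_atTop) w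
  have h2 := hd x
  rw [Metric.infDist_zero_of_mem hxF] at h2
  have h3 := hd w
  have h4 : 0 ≤ Metric.infDist w F := Metric.infDist_nonneg
  linarith

end Subgradient

/-! ### Covering by DC graphs -/

/-- The closed unit square with lower left corner `(i, j)`. -/
def unitCell (z : ℤ × ℤ) : Set (EuclideanSpace ℝ (Fin 2)) :=
  {x | x 0 ∈ Icc (z.1 : ℝ) (z.1 + 1) ∧ x 1 ∈ Icc (z.2 : ℝ) (z.2 + 1)}

theorem exists_mem_unitCell (x : EuclideanSpace ℝ (Fin 2)) : ∃ z, x ∈ unitCell z :=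
  ⟨(⌊x 0⌋, ⌊x 1⌋), ⟨Int.floor_le _, (Int.lt_floor_add_one _).le⟩,
    ⟨Int.floor_le _, (Int.lt_floor_add_one _).le⟩⟩

theorem exists_norm_le_of_mem_unitCell (z : ℤ × ℤ) : ∃ R, ∀ x ∈ unitCell z, ‖x‖ ≤ R := by
  refine ⟨√((|(z.1 : ℝ)| + 1) ^ 2 + (|(z.2 : ℝ)| + 1) ^ 2), fun x hx => ?_⟩
  obtain ⟨⟨h1, h2⟩, h3, h4⟩ := hx
  rw [EuclideanSpace.norm_eq, Fin.sum_univ_two]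
  have habs : ∀ a r : ℝ, a ≤ r → r ≤ a + 1 → |r| ≤ |a| + 1 := by
    intro a r ha hr
    rw [abs_le]
    constructor <;> linarith [le_abs_self a, neg_abs_le a]
  simp only [Real.norm_eq_abs]
  gcongr
  · exact habs _ _ h1 h2
  · exact habs _ _ h3 h4

theorem locallyFinite_unitCell : LocallyFinite unitCell := by
  intro x
  refine ⟨Metric.ball x 1, Metric.ball_mem_nhds _ one_pos, ?_⟩
  refine ((finite_Icc (⌊x 0⌋ - 2) (⌊x 0⌋ + 2)).prod (finite_Icc (⌊x 1⌋ - 2) (⌊x 1⌋ + 2))).subset ?_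
  rintro z ⟨y, ⟨⟨h1, h2⟩, h3, h4⟩, hy⟩
  have hco : ∀ i, |y i - x i| < 1 := fun i => by
    have := (PiLp.norm_apply_le (y - x) i).trans_lt (by simpa [dist_eq_norm] using hy)
    simpa using this
  have hint : ∀ (n : ℤ) (a b : ℝ), n ≤ a → a ≤ n + 1 → |a - b| < 1 →
      n ∈ Icc (⌊b⌋ - 2) (⌊b⌋ + 2) := by
    intro n a b ha ha' hab
    rw [abs_lt] at hab
    have hb := Int.floor_le b
    have hb' := Int.lt_floor_add_one b
    constructor
    · have : ((⌊b⌋ - 2 : ℤ) : ℝ) ≤ n := by push_cast; linarith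
      exact_mod_cast this
    · have : (n : ℝ) ≤ (⌊b⌋ + 2 : ℤ) := by push_cast; linarith
      exact_mod_cast this
  exact ⟨hint _ _ _ h1 h2 (hco 0), hint _ _ _ h3 h4 (hco 1)⟩

theorem planeRotation_zero (p : EuclideanSpace ℝ (Fin 2)) : planeRotation 0 p = p := by
  ext i
  fin_cases i <;> simp [planeRotation]

/-- The part in a unit cell of the graph of a DC function over the first coordinate axis is
covered by a DC graph in the cell. -/
theorem IsDC.exists_isDCGraph_snd {f : ℝ → ℝ} (hf : IsDC f) (z : ℤ × ℤ) :
    ∃ P, IsDCGraph P ∧ P ⊆ unitCell z ∧ ∀ x ∈ unitCell z, x 1 = f (x 0) → x ∈ P := by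
  -- Clamping keeps the graph inside the cell and changes nothing where it already meets it.
  refine ⟨planeRotation 0 '' graphOver (fun t => max (min (f t) (z.2 + 1)) z.2)
      (Icc z.1 (z.1 + 1)),
    ⟨_, _, _, _, (hf.min_const _).max_const _, by linarith, rfl⟩, ?_, fun x hx hxf => ?_⟩
  · rintro _ ⟨_, ⟨t, ht, rfl⟩, rfl⟩
    rw [planeRotation_zero]
    exact ⟨by simpa using ht, by simp⟩
  · refine ⟨x, ⟨x 0, hx.1, ?_⟩, planeRotation_zero x⟩
    ext i
    fin_cases i
    · simp
    · simp [← hxf, min_eq_left hx.2.2, max_eq_left hx.2.1]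

/-- The part in a unit cell of the graph of a DC function over the second coordinate axis is
covered by a DC graph in the cell. -/
theorem IsDC.exists_isDCGraph_fst {f : ℝ → ℝ} (hf : IsDC f) (z : ℤ × ℤ) :
    ∃ P, IsDCGraph P ∧ P ⊆ unitCell z ∧ ∀ x ∈ unitCell z, x 0 = f (x 1) → x ∈ P := by
  have hrot : ∀ p : EuclideanSpace ℝ (Fin 2), planeRotation (Real.pi / 2) p = !₂[-p 1, p 0] := by
    intro p
    ext i
    fin_cases i <;> simp [planeRotation]
  -- The quarter turn sends `(t, -r)` to `(r, t)`, hence the sign.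
  refine ⟨planeRotation (Real.pi / 2) '' graphOver (fun t => -max (min (f t) (z.1 + 1)) z.1)
      (Icc z.2 (z.2 + 1)),
    ⟨_, _, _, _, ((hf.min_const _).max_const _).neg, by linarith, rfl⟩, ?_, fun x hx hxf => ?_⟩
  · rintro _ ⟨_, ⟨t, ht, rfl⟩, rfl⟩
    rw [hrot]
    exact ⟨by simp, by simpa using ht⟩
  · refine ⟨_, ⟨x 1, hx.2, rfl⟩, ?_⟩
    rw [hrot]
    ext i
    fin_cases i
    · simp [← hxf, min_eq_left hx.1.2, max_eq_left hx.1.1]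
    · simp

/-- Set of points where `g` has subgradients whose `i`-th coordinates lie on different sides of
the interval `[k / 4, (k + 1) / 4]`. -/
def subgradientGap (g : EuclideanSpace ℝ (Fin 2) → ℝ) (i : Fin 2) (k : ℤ) :
    Set (EuclideanSpace ℝ (Fin 2)) :=
  {x | ∃ p q, IsSubgradient g p x ∧ IsSubgradient g q x ∧ p i ≤ k / 4 ∧ ((k : ℝ) + 1) / 4 ≤ q i}

theorem ConvexOn.exists_isDCGraph_of_subgradientGap {g : EuclideanSpace ℝ (Fin 2) → ℝ}
    (hg : ConvexOn ℝ univ g) (i : Fin 2) (k : ℤ) (z : ℤ × ℤ) :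
    ∃ P, IsDCGraph P ∧ P ⊆ unitCell z ∧ subgradientGap g i k ∩ unitCell z ⊆ P := by
  have hc : (k : ℝ) / 4 < (k + 1) / 4 := by linarith
  have hin : ∀ p x : EuclideanSpace ℝ (Fin 2), ⟪p, x⟫ = p 0 * x 0 + p 1 * x 1 := by
    intro p x
    simp [PiLp.inner_apply, mul_comm]
  have hconv : ∀ L : ℝ × ℝ →ₗ[ℝ] EuclideanSpace ℝ (Fin 2),
      ConvexOn ℝ univ (fun w => g (L w)) := fun L => by
    simpa [Function.comp_def] using hg.comp_linearMap L
  fin_cases i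
  · obtain ⟨f, hf, hfG⟩ := (show ConvexOn ℝ univ fun w : ℝ × ℝ => g !₂[w.2, w.1] from
      hconv ⟨⟨fun w => !₂[w.2, w.1], fun a b => by ext i; fin_cases i <;> simp⟩,
        fun a b => by ext i; fin_cases i <;> simp⟩).exists_isDC_of_slopeGap hc
    obtain ⟨P, hP, hPz, hfP⟩ := hf.exists_isDCGraph_fst z
    refine ⟨P, hP, hPz, fun x hx => hfP x hx.2 (hfG _ _ ?_)⟩
    obtain ⟨p, q, hp, hq, hpk, hqk⟩ := hx.1
    have hxe : !₂[x 0, x 1] = x := by ext i; fin_cases i <;> simp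
    refine ⟨p 1, p 0, q 1, q 0, hpk, hqk, fun u v => ?_, fun u v => ?_⟩
    · have := hp !₂[v, u]
      simp [hin] at this
      simp only [hxe]
      linarith
    · have := hq !₂[v, u]
      simp [hin] at this
      simp only [hxe]
      linarith
  · obtain ⟨f, hf, hfG⟩ := (show ConvexOn ℝ univ fun w : ℝ × ℝ => g !₂[w.1, w.2] from
      hconv ⟨⟨fun w => !₂[w.1, w.2], fun a b => by ext i; fin_cases i <;> simp⟩,
        fun a b => by ext i; fin_cases i <;> simp⟩).exists_isDC_of_slopeGap hc
    obtain ⟨P, hP, hPz, hfP⟩ := hf.exists_isDCGraph_snd z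
    refine ⟨P, hP, hPz, fun x hx => hfP x hx.2 (hfG _ _ ?_)⟩
    obtain ⟨p, q, hp, hq, hpk, hqk⟩ := hx.1
    have hxe : !₂[x 0, x 1] = x := by ext i; fin_cases i <;> simp
    refine ⟨p 0, p 1, q 0, q 1, hpk, hqk, fun u v => ?_, fun u v => ?_⟩
    · have := hp !₂[u, v]
      simp [hin] at this
      simp only [hxe]
      linarith
    · have := hq !₂[u, v]
      simp [hin] at this
      simp only [hxe]
      linarith

theorem exists_mem_subgradientGap {g : EuclideanSpace ℝ (Fin 2) → ℝ}
    {p q x : EuclideanSpace ℝ (Fin 2)} (hp : IsSubgradient g p x) (hq : IsSubgradient g q x)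
    (hpq : 1 ≤ ‖p - q‖) {L : ℝ} (hpL : ‖p‖ ≤ L) (hqL : ‖q‖ ≤ L) :
    ∃ i, ∃ k ∈ Icc (-⌈4 * L⌉) ⌈4 * L⌉, x ∈ subgradientGap g i k := by
  have hco : ∃ i, 1 / 2 ≤ |p i - q i| := by
    by_contra! hlt
    have h0 := hlt 0
    have h1 := hlt 1
    have h2 : 1 ≤ ‖p - q‖ ^ 2 := one_le_pow₀ hpq
    rw [EuclideanSpace.norm_sq_eq, Fin.sum_univ_two] at h2
    simp only [PiLp.sub_apply, Real.norm_eq_abs] at h2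
    nlinarith [abs_nonneg (p 0 - q 0), abs_nonneg (p 1 - q 1)]
  obtain ⟨i, hi⟩ := hco
  have key : ∀ {p q : EuclideanSpace ℝ (Fin 2)}, IsSubgradient g p x → IsSubgradient g q x →
      ‖p‖ ≤ L → p i + 1 / 2 ≤ q i → ∃ k ∈ Icc (-⌈4 * L⌉) ⌈4 * L⌉, x ∈ subgradientGap g i k := by
    intro p q hp hq hpL hle
    have hpi := abs_le.1 ((PiLp.norm_apply_le p i).trans hpL)
    have h1 := Int.le_ceil (4 * p i)
    have h2 := Int.ceil_lt_add_one (4 * p i)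
    -- Rounding up loses less than 1/4, so `(k + 1) / 4 < p i + 1 / 2 ≤ q i`.
    refine ⟨⌈4 * p i⌉, ⟨?_, Int.ceil_le_ceil (by linarith)⟩, p, q, hp, hq, by linarith, by linarith⟩
    have h3 : (-⌈4 * L⌉ : ℝ) ≤ ⌈4 * p i⌉ := by linarith [Int.le_ceil (4 * L)]
    exact_mod_cast h3
  rcases le_total (p i) (q i) with h | h
  · exact ⟨i, key hp hq hpL (by rw [abs_of_nonpos (by linarith)] at hi; linarith)⟩
  · exact ⟨i, key hq hp hqL (by rw [abs_of_nonneg (by linarith)] at hi; linarith)⟩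

theorem exists_finite_cover_frontier_inter_unitCell {F : Set (EuclideanSpace ℝ (Fin 2))}
    (hF : IsClosed F) (hd : IsDC fun x => Metric.infDist x F) (z : ℤ × ℤ) :
    ∃ S : Set (Set (EuclideanSpace ℝ (Fin 2))), S.Finite ∧ (∀ P ∈ S, IsDCGraph P) ∧
      (∀ P ∈ S, P ⊆ unitCell z) ∧ frontier F ∩ unitCell z ⊆ ⋃₀ S := by
  obtain ⟨g, h, hg, hh, hd⟩ := hd
  obtain ⟨R, hR⟩ := exists_norm_le_of_mem_unitCell z
  obtain ⟨L, hL⟩ := exists_norm_le_of_isSubgradient hg.locallyLipschitz.continuous R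
  choose P hP hPz hgP using fun ik : Fin 2 × ℤ =>
    hg.exists_isDCGraph_of_subgradientGap ik.1 ik.2 z
  refine ⟨P '' (univ ×ˢ Icc (-⌈4 * L⌉) ⌈4 * L⌉), (finite_univ.prod (finite_Icc _ _)).image P,
    forall_mem_image.2 fun ik _ => hP ik, forall_mem_image.2 fun ik _ => hPz ik, ?_⟩
  rintro x ⟨hxF, hxz⟩
  obtain ⟨p, q, hp, hq, hpq⟩ := exists_isSubgradient_of_mem_frontier hF hg hh hd hxF
  obtain ⟨i, k, hk, hx⟩ := exists_mem_subgradientGap hp hq hpq (hL x p (hR x hxz) hp)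
    (hL x q (hR x hxz) hq)
  exact ⟨P (i, k), mem_image_of_mem P ⟨mem_univ _, hk⟩, hgP (i, k) ⟨hx, hxz⟩⟩

theorem corollary4p8 (F : Set (EuclideanSpace ℝ (Fin 2))) (hF : F ∈ DCDistanceSets 2) :
    ∃ 𝒢 : Set (Set (EuclideanSpace ℝ (Fin 2))),
      (∀ P ∈ 𝒢, IsDCGraph P) ∧
      LocallyFinite (fun P : 𝒢 => (P : Set (EuclideanSpace ℝ (Fin 2)))) ∧
      frontier F ⊆ ⋃₀ 𝒢 := by
  rcases hF with rfl | ⟨-, hF, hd⟩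
  · exact ⟨∅, by simp, fun x => ⟨univ, univ_mem, toFinite _⟩, by simp⟩
  choose S hfin hS hSz hcov using exists_finite_cover_frontier_inter_unitCell hF hd
  refine ⟨⋃ z, S z, fun P hP => ?_, fun x => ?_, fun x hx => ?_⟩
  · obtain ⟨z, hz⟩ := mem_iUnion.1 hP
    exact hS z P hz
  · obtain ⟨U, hU, hUfin⟩ := locallyFinite_unitCell x
    -- A graph of `S z` meeting `U` lies in cell `z`, so that cell is one of the finitely many
    -- meeting `U`.
    refine ⟨U, hU, ((hUfin.biUnion fun z _ => hfin z).preimage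
      Subtype.val_injective.injOn).subset ?_⟩
    rintro ⟨P, hP⟩ hPU
    obtain ⟨z, hz⟩ := mem_iUnion.1 hP
    exact mem_biUnion (show z ∈ {z | (unitCell z ∩ U).Nonempty} from
      hPU.mono (inter_subset_inter_left U (hSz z P hz))) hz
  · obtain ⟨z, hz⟩ := exists_mem_unitCell x
    obtain ⟨P, hP, hxP⟩ := hcov z ⟨hx, hz⟩
    exact ⟨P, mem_iUnion.2 ⟨z, hP⟩, hxP⟩
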